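/- Let $x_1,\dots,x_n\in\mathbb R^d$ be a fixed sequence of vectors with $\|x_i\|_2\le 1$ (an oblivious adversary), let $\alpha_1,\dots,\alpha_k>0$ be weights of $k$ treatments $m_1,\dots,m_k$, and let $\phi,\delta\in(0,1)$. If $\boldsymbol s(m)\in\mathbb R^d$ denotes the sum of the vectors assigned to treatment $m$, the multi-treatment discrepancy of an assignment is $$\max_{1\le a,b\le k}\;2\left\|\frac{\boldsymbol s(m_a)/\alpha_a-\boldsymbol s(m_b)/\alpha_b}{1/\alpha_a+1/\alpha_b}\right\|_\infty .$$ BinaryBalance with parameters $q\in(0,1/2]$ and $\delta'$. Put $c=\min(1/q,\,9.3)\log(2n/\delta')$ and start with $w=0$. On an input $y$: if $|\langle w,y\rangle|>c$, no sign is produced and $w$ is replaced by $w-2q\frac{\langle w,y\rangle}{c}\,y$. Otherwise a sign is drawn with fresh randomness, $+$ (that is, $\eta=2(1-q)$) with probability $q(1-\langle w,y\rangle/c)$ and $-$ (that is, $\eta=-2q$) with the remaining probability, and $w$ is replaced by $w+\eta y$. KGroupBalance. Let $h$ be the smallest integer with $2^h\ge k$. Take a complete binary tree of height $h$, remove $2^h-k$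 leaves, no two of them siblings, contract every internal node with only one child to this child, and associate the $k$ remaining leaves one-to-one with the treatments; call the result $T$. For a node $v$ let $\alpha(v)$ be the sum of the weights of the treatments at leaves under $v$; the children of an internal node $v$ are named $v_l,v_r$ so that $\alpha(v_l)\le\alpha(v_r)$. Every internal node $v$ runs its own independent BinaryBalance with $q=\frac{\alpha(v_l)}{\alpha(v_l)+\alpha(v_r)}$ and $\delta'=\delta/k$ (so its signs are $2\frac{\alpha(v_r)}{\alpha(v_l)+\alpha(v_r)}$ and $-2\frac{\alpha(v_l)}{\alpha(v_l)+\alpha(v_r)}$). For $i=1,\dots,n$, the augmented vector $(\sqrt\phi\,e_i,\sqrt{1-\phi}\,x_i)\in\mathbb R^{n+d}$, where $e_i$ is the $i$-th standard basis vector of $\mathbb R^n$, is fed to the root, then to the left child if the sign is $+$ and to the right child if it is $-$, and so on until a leaf is reached; unit $i$ is assigned to the treatment of that leaf (and to none if some balancer on the way produces no sign). Theorem. There is an absolute constant $C>0$ such that for all such $n,d,k,x,\alpha,T,\phi,\delta$, with probability at least $1-\delta$ KGroupBalance assigns every unit to a treatment and the multi-treatment discrepancy of the assignment is at most $$C\,\log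 k\,\sqrt{\frac{d\,\log(dk/\delta)\,\log(nk/\delta)}{\phi(1-\phi)}}\,.$$ -/

import Mathlib

open scoped ENNReal

noncomputable section

namespace KGroup

/-! ### The binary tree of treatments -/

/-- Binary trees in which every internal node has two children (left, right) and every leaf
carries a label. -/
inductive BinTree (β : Type) : Type
  | leaf (b : β) : BinTree β
  | node (l r : BinTree β) : BinTree β

namespace BinTree

variable {β : Type}

/-- The labels of the leaves, from left to right. -/
def leaves : BinTree β → List β
  | leaf b => [b]
  | node l r => leaves l ++ leaves r

/-- `T.IsComplete h`: all leaves of `T` lie at depth exactly `h`. -/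
def IsComplete : ℕ → BinTree β → Prop
  | 0, leaf _ => True
  | h + 1, node l r => IsComplete h l ∧ IsComplete h r
  | _, _ => False

/-- Leaves labelled `none` are those to be removed; no two sibling leaves are both removed. -/
def NoSiblingsRemoved : BinTree (Option β) → Prop
  | leaf _ => True
  | node (leaf none) (leaf none) => False
  | node l r => NoSiblingsRemoved l ∧ NoSiblingsRemoved r

/-- Remove the leaves labelled `none`, and contract every internal node that is left with a single
child to this child (the value is `none` if nothing is left). -/
def prune : BinTree (Option β) → Option (BinTree β)
  | leaf none => none
  | leaf (some b) => some (leaf b)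
  | node l r =>
    match prune l, prune r with
    | some l', some r' => some (node l' r')
    | some l', none => some l'
    | none, some r' => some r'
    | none, none => none

/-- `α(v)`: the sum of the weights of the treatments at the leaves under the root `v`. -/
def weight (α : β → ℝ) : BinTree β → ℝ
  | leaf b => α b
  | node l r => weight α l + weight α r

/-- At every internal node the left child is the one of smaller (or equal) weight. So the
parameter `q = α(v_l) / (α(v_l) + α(v_r))` of the binary balancer is at most `1/2`, which makes the
numbers `q (1 - ⟪w, x⟫ / c)`, `|⟪w, x⟫| ≤ c`, probabilities. -/
def LighterLeft (α : β → ℝ) : BinTree β → Prop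
  | leaf _ => True
  | node l r => weight α l ≤ weight α r ∧ LighterLeft α l ∧ LighterLeft α r

end BinTree

/-- `T` is a tree that can be built for the `k` treatments `Fin k`: for the smallest `h` with
`k ≤ 2 ^ h`, take a complete binary tree of height `h`, remove leaves, no two of them siblings, so
that `k` leaves remain, associate each treatment with exactly one of them, and contract the
internal nodes with one child. -/
def IsTreatmentTree {k : ℕ} (T : BinTree (Fin k)) : Prop :=
  ∃ S : BinTree (Option (Fin k)),
    S.IsComplete (Nat.clog 2 k) ∧ S.NoSiblingsRemoved ∧
      (∀ m : Fin k, S.leaves.count (some m) = 1) ∧ S.prune = some T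

/-! ### The weighted binary balancer -/

/-- A coin that shows `true` with probability `p` (with `p` truncated to `[0, 1]`). -/
def coin (p : ℝ) : PMF Bool :=
  PMF.ofFintype
    (fun b => ENNReal.ofReal (if b then max 0 (min 1 p) else 1 - max 0 (min 1 p))) (by
      have h0 : 0 ≤ max 0 (min 1 p) := le_max_left _ _
      have h1 : 0 ≤ 1 - max 0 (min 1 p) :=
        sub_nonneg.2 (max_le zero_le_one (min_le_left _ _))
      simp only [Fintype.sum_bool, if_true, Bool.false_eq_true, if_false]
      rw [← ENNReal.ofReal_add h0 h1]
      simp)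

/-- The threshold `c = min (1/q, 9.3) log (2n/δ)` of the balancer with failure parameter `δ`. -/
def threshold (n : ℕ) (δ q : ℝ) : ℝ :=
  min (1 / q) 9.3 * Real.log (2 * n / δ)

/-- The weighted sign: `2(1-q)` for `+` (`true`) and `-2q` for `-` (`false`). -/
def weightedSign (q : ℝ) (b : Bool) : ℝ :=
  if b then 2 * (1 - q) else -2 * q

variable {E : Type} [NormedAddCommGroup E] [InnerProductSpace ℝ E]

/-- One round of the binary balancer in state `w` on the input `x`. It returns the new state and
the sign; no sign is produced (`none`) if `|⟪w, x⟫| > c`. -/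
def binaryStep (q c : ℝ) (w x : E) : PMF (E × Option Bool) :=
  open scoped Classical in
  if c < |inner ℝ w x| then
    PMF.pure (w - (2 * q * (inner ℝ w x / c)) • x, none)
  else
    (coin (q * (1 - inner ℝ w x / c))).map fun b => (w + weightedSign q b • x, some b)

/-! ### The multi-treatment algorithm -/

/-- The running state of the multi-treatment algorithm: the treatment tree, where each internal
node holds the parameter `q` and the current state `w` of its own binary balancer. -/
inductive Balancers (E : Type) (β : Type) : Type
  | leaf (b : β) : Balancers E β
  | node (q : ℝ) (w : E) (l r : Balancers E β) : Balancers E β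

/-- At each internal node `v` start a balancer with `q = α(v_l) / (α(v_l) + α(v_r))` and `w = 0`;
half of its weighted signs are `α(v_r) / (α(v_l) + α(v_r))` and `-α(v_l) / (α(v_l) + α(v_r))`. -/
def initialState {β : Type} (E : Type) [Zero E] (α : β → ℝ) : BinTree β → Balancers E β
  | .leaf b => .leaf b
  | .node l r =>
    .node (l.weight α / (l.weight α + r.weight α)) 0 (initialState E α l) (initialState E α r)

/-- Process one vector `x`: feed it to the balancer at the root, go on in the left subtree if the
sign is `+` and in the right one if it is `-`, until a leaf is reached. It returns the new state
and the label of that leaf, or `none` if a balancer on the way produced no sign. The balancer of a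
node with parameter `q` uses the threshold `c q`. -/
def assignStep {β : Type} (c : ℝ → ℝ) (x : E) : Balancers E β → PMF (Balancers E β × Option β)
  | .leaf b => PMF.pure (.leaf b, some b)
  | .node q w l r =>
    (binaryStep q (c q) w x).bind fun s =>
      match s.2 with
      | none => PMF.pure (.node q s.1 l r, none)
      | some true => (assignStep c x l).map fun t => (.node q s.1 t.1 r, t.2)
      | some false => (assignStep c x r).map fun t => (.node q s.1 l t.1, t.2)

/-- Process the vectors `x 0, …, x (n - 1)` one after the other, with fresh randomness in every
binary round. The result is the law of the assignment of the units to the labels. -/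
def assignAll {β : Type} (c : ℝ → ℝ) :
    (n : ℕ) → (Fin n → E) → Balancers E β → PMF (Fin n → Option β)
  | 0, _, _ => PMF.pure Fin.elim0
  | n + 1, x, s =>
    (assignStep c (x 0) s).bind fun t =>
      (assignAll c n (fun i => x i.succ) t.1).map fun a => (Fin.cons t.2 a : Fin (n + 1) → Option β)

/-- The augmented covariates `(√φ eᵢ, √(1-φ) xᵢ)`, where `eᵢ` is the `i`-th basis vector of `ℝⁿ`. -/
def augment {n d : ℕ} (φ : ℝ) (x : Fin n → EuclideanSpace ℝ (Fin d)) (i : Fin n) :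
    EuclideanSpace ℝ (Fin n ⊕ Fin d) :=
  WithLp.toLp 2 (Sum.elim (fun j => Real.sqrt φ * if j = i then 1 else 0)
    (fun j => Real.sqrt (1 - φ) * x i j))

/-- The multi-treatment algorithm on the tree `T` with treatment weights `α`, augmentation
parameter `φ` and failure probability `δ`: every internal node runs its own binary balancer with
failure parameter `δ / k` on the augmented covariates. The value is the law of the assignment of the
`n` units to the treatments. -/
def kGroupBalance {n d k : ℕ} (T : BinTree (Fin k)) (α : Fin k → ℝ) (φ δ : ℝ)
    (x : Fin n → EuclideanSpace ℝ (Fin d)) : PMF (Fin n → Option (Fin k)) :=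
  assignAll (threshold n (δ / k)) n (augment φ x)
    (initialState (EuclideanSpace ℝ (Fin n ⊕ Fin d)) α T)

/-! ### Multi-treatment discrepancy -/

/-- `s(m)`: the sum of the vectors assigned to treatment `m`. As an element of `Fin d → ℝ` its norm
is the `ℓ^∞` norm. -/
def groupSum {n d k : ℕ} (x : Fin n → EuclideanSpace ℝ (Fin d)) (a : Fin n → Option (Fin k))
    (m : Fin k) : Fin d → ℝ :=
  fun j => ∑ i : Fin n, if a i = some m then x i j else 0

/-- The multi-treatment discrepancy
`max_{m₁, m₂} 2 ‖(s(m₁) / α₁ - s(m₂) / α₂) / (1 / α₁ + 1 / α₂)‖_∞`. -/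
def multiDiscrepancy {n d k : ℕ} (α : Fin k → ℝ) (x : Fin n → EuclideanSpace ℝ (Fin d))
    (a : Fin n → Option (Fin k)) : ℝ :=
  ⨆ m : Fin k × Fin k,
    2 * ‖(1 / α m.1 + 1 / α m.2)⁻¹ •
      ((α m.1)⁻¹ • groupSum x a m.1 - (α m.2)⁻¹ • groupSum x a m.2)‖

end KGroup

end

/-!
A balancer with parameter `q` and threshold `c` replaces its state `w` by `w + η y`, where the
conditional mean of `η` is `-(2q/c) ⟪w, y⟫`. So a round contracts `w` by `1 - (2q/c) y yᵀ` and adds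
centred noise along `y`; a round without a sign only contracts. If `v` is a large enough multiple of
`c`, then the loss of `exp (v ‖u‖² / 2)` under the contraction pays for the exponential moment of
the noise. This makes `potential v u w = exp (-v ‖u‖² / 2) cosh ⟪w, u⟫` decrease in expectation when
`u` is pulled back by the contraction (`VarianceProxy.expect_potential_le`). Hence on a fixed
sequence of inputs the state has Gaussian tails of variance `v = O(log (nk/δ))`, at least in
directions of bounded length. Both the probability that a round produces no sign and the
probability that a coordinate of the final state is large follow by the exponential Markov
inequality (`VarianceProxy.run_not_signsGood_le`, with parameters as in `exists_varianceProxy` and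
`exists_state_tail_le`).

Inside the tree, the inputs of a balancer depend on the signs of its ancestors, but not on its own
signs. Accordingly the run on the tree has the same law as the procedure in which the root
processes the whole sequence first, and the subtrees then process what was routed to them
(`run_node`). So the bounds for fixed sequences apply to every node, and a union bound over the
nodes finishes the probabilistic part (`run_not_treeGood_le`).

If no balancer fails, then the final state of a node is twice the deviation of the sum at its left
child from its proportional share of the sum at the node. Adding these deviations along the path
from the root to a leaf, each group sum differs from its proportional share of the total by at most
half the depth times the bound on the states (`TreeGood.node`), and the depth is at most
`3 log k`.
-/

open scoped ENNReal

noncomputable section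

namespace KGroup

section

variable {E : Type} [NormedAddCommGroup E] [InnerProductSpace ℝ E]

/-! ### Centred coins -/

/-- Hoeffding's lemma for a coin: twice a centred coin lies in an interval of length `2`. -/
theorem centred_coin_le_exp_half {p : ℝ} (h0 : 0 ≤ p) (h1 : p ≤ 1) (s : ℝ) :
    p * Real.exp (2 * (1 - p) * s) + (1 - p) * Real.exp (-(2 * p) * s) ≤
      Real.exp (s ^ 2 / 2) := by
  have hp : max 0 (min 1 p) = p := by rw [min_eq_right h1, max_eq_right h0]
  let μ : MeasureTheory.Measure Bool := (coin p).toMeasure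
  have hint : ∀ f : Bool → ℝ, ∫ b, f b ∂μ = p * f true + (1 - p) * f false := by
    intro f
    rw [PMF.integral_eq_sum, Fintype.sum_bool]
    simp only [coin, PMF.ofFintype_apply, if_true, Bool.false_eq_true, if_false, hp, smul_eq_mul]
    rw [ENNReal.toReal_ofReal h0, ENNReal.toReal_ofReal (by linarith)]
  have key := ProbabilityTheory.hasSubgaussianMGF_of_mem_Icc_of_integral_eq_zero
    (μ := μ) (X := fun b : Bool => if b then 2 * (1 - p) else -(2 * p)) (a := -(2 * p))
    (b := 2 * (1 - p)) (measurable_of_finite _).aemeasurable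
    (Filter.Eventually.of_forall fun b => by
      cases b <;> simp <;> linarith) (by rw [hint]; simp; ring)
  have h := key.mgf_le s
  rw [ProbabilityTheory.mgf, hint] at h
  have e : (((‖2 * (1 - p) - -(2 * p)‖₊ / 2) ^ 2 : NNReal) : ℝ) = 1 := by
    rw [show 2 * (1 - p) - -(2 * p) = 2 by ring]
    simp
  rw [e] at h
  simpa [mul_comm] using h

/-- A Bernstein type bound, better than Hoeffding's lemma for a biased coin. -/
theorem centred_coin_le_exp_bias {p q : ℝ} (h0 : 0 ≤ p) (hq : p ≤ 2 * q) {s : ℝ}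
    (hs : |s| ≤ 1 / 2) :
    p * Real.exp (2 * (1 - p) * s) + (1 - p) * Real.exp (-(2 * p) * s) ≤
      Real.exp (8 * q * s ^ 2) := by
  have e1 : Real.exp (2 * (1 - p) * s) = Real.exp (2 * s) * Real.exp (-(2 * p) * s) := by
    rw [← Real.exp_add]; ring_nf
  have hx : |2 * s| ≤ 1 := by rw [abs_mul, abs_two]; linarith
  have h1 : Real.exp (2 * s) ≤ 1 + 2 * s + (2 * s) ^ 2 := by
    have := (abs_le.1 (Real.abs_exp_sub_one_sub_id_le hx)).2
    linarith
  have h2 : p * Real.exp (2 * s) + (1 - p) ≤ Real.exp (2 * p * s + 4 * p * s ^ 2) := by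
    refine le_trans ?_ (Real.add_one_le_exp _)
    nlinarith
  calc p * Real.exp (2 * (1 - p) * s) + (1 - p) * Real.exp (-(2 * p) * s)
      = (p * Real.exp (2 * s) + (1 - p)) * Real.exp (-(2 * p) * s) := by rw [e1]; ring
    _ ≤ Real.exp (2 * p * s + 4 * p * s ^ 2) * Real.exp (-(2 * p) * s) := by gcongr
    _ = Real.exp (4 * p * s ^ 2) := by rw [← Real.exp_add]; ring_nf
    _ ≤ Real.exp (8 * q * s ^ 2) := by
      apply Real.exp_le_exp.2
      nlinarith [sq_nonneg s]

/-! ### The potential of a binary balancer -/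

/-- The expectation of a nonnegative function under a probability mass function. -/
def expect {A : Type*} (p : PMF A) (f : A → ℝ≥0∞) : ℝ≥0∞ := ∑' a, p a * f a

theorem expect_mono {A : Type*} (p : PMF A) {f g : A → ℝ≥0∞} (h : ∀ a, f a ≤ g a) :
    expect p f ≤ expect p g :=
  ENNReal.tsum_le_tsum fun a => mul_le_mul_right (h a) _

theorem expect_const_mul {A : Type*} (p : PMF A) (k : ℝ≥0∞) (f : A → ℝ≥0∞) :
    expect p (fun a => k * f a) = k * expect p f := by
  unfold expect
  rw [← ENNReal.tsum_mul_left]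
  exact tsum_congr fun a => by ring

theorem expect_pure {A : Type*} (a : A) (f : A → ℝ≥0∞) : expect (PMF.pure a) f = f a := by
  unfold expect
  rw [tsum_eq_single a (fun b hb => by simp [PMF.pure_apply, hb])]
  simp

theorem expect_map {A B : Type*} (p : PMF A) (g : A → B) (f : B → ℝ≥0∞) :
    expect (p.map g) f = expect p (f ∘ g) := by
  unfold expect
  simp only [PMF.map_apply, ← ENNReal.tsum_mul_right, Function.comp]
  rw [ENNReal.tsum_comm]
  refine tsum_congr fun a => ?_
  rw [tsum_eq_single (g a) (fun b hb => by simp [hb])]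
  simp

theorem expect_coin {p : ℝ} (h0 : 0 ≤ p) (h1 : p ≤ 1) (f : Bool → ℝ) (hf : ∀ b, 0 ≤ f b) :
    expect (coin p) (fun b => ENNReal.ofReal (f b)) =
      ENNReal.ofReal (p * f true + (1 - p) * f false) := by
  have hp : max 0 (min 1 p) = p := by rw [min_eq_right h1, max_eq_right h0]
  unfold expect
  rw [tsum_fintype, Fintype.sum_bool]
  simp only [coin, PMF.ofFintype_apply, if_true, Bool.false_eq_true, if_false, hp]
  rw [← ENNReal.ofReal_mul h0, ← ENNReal.ofReal_mul (by linarith), ← ENNReal.ofReal_add]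
  · exact mul_nonneg h0 (hf _)
  · exact mul_nonneg (by linarith) (hf _)

/-- The symmetrised exponential moment in direction `u`, normalised by the value
`exp (v ‖u‖² / 2)` that it would have for a Gaussian of variance `v` in each direction. -/
def potential (v : ℝ) (u w : E) : ℝ :=
  Real.exp (-(v * ‖u‖ ^ 2 / 2)) * Real.cosh (inner ℝ w u)

theorem potential_nonneg (v : ℝ) (u w : E) : 0 ≤ potential v u w :=
  mul_nonneg (Real.exp_pos _).le (Real.cosh_pos _).le

/-- `v` is a variance proxy for the balancer with parameter `q` and threshold `c`, as far as
directions of length at most `r` are concerned: in such a direction, the exponential moment of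
the centred sign is paid for by the contraction `w ↦ w - (2q/c) ⟪w, y⟫ y`, which is the drift of
the state. -/
structure VarianceProxy (q c v r : ℝ) : Prop where
  q_pos : 0 < q
  q_le_half : q ≤ 1 / 2
  q_le : q ≤ c
  v_nonneg : 0 ≤ v
  coin_le : ∀ p s : ℝ, 0 ≤ p → p ≤ 2 * q → |s| ≤ r →
    p * Real.exp (2 * (1 - p) * s) + (1 - p) * Real.exp (-(2 * p) * s) ≤
      Real.exp (v * (2 * q / c * (1 - q / c)) * s ^ 2)

theorem norm_sub_smul_inner_sq_le {q c : ℝ} (hc : 0 < c) {y : E} (hy : ‖y‖ ≤ 1)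
    (u : E) :
    ‖u - (2 * q / c * inner ℝ y u) • y‖ ^ 2 ≤
      ‖u‖ ^ 2 - 2 * (2 * q / c * (1 - q / c)) * (inner ℝ y u) ^ 2 := by
  rw [@norm_sub_sq_real, norm_smul, inner_smul_right, mul_pow, Real.norm_eq_abs, sq_abs,
    real_inner_comm y u]
  have h1 : ‖y‖ ^ 2 ≤ 1 := by nlinarith [norm_nonneg y]
  have h2 : (2 * q / c * inner ℝ y u) ^ 2 * ‖y‖ ^ 2 ≤ (2 * q / c * inner ℝ y u) ^ 2 :=
    mul_le_of_le_one_right (sq_nonneg _) h1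
  have h3 : (2 * q / c * inner ℝ y u) ^ 2 = 4 * (q / c) ^ 2 * (inner ℝ y u) ^ 2 := by
    field_simp; ring
  have h4 : 2 * (2 * q / c * (1 - q / c)) * (inner ℝ y u) ^ 2 =
      4 * (q / c) * (inner ℝ y u) ^ 2 - 4 * (q / c) ^ 2 * (inner ℝ y u) ^ 2 := by
    field_simp; ring
  have h5 : 2 * (2 * q / c * inner ℝ y u * inner ℝ y u) =
      4 * (q / c) * (inner ℝ y u) ^ 2 := by field_simp; ring
  linarith

theorem VarianceProxy.c_pos {q c v r : ℝ} (h : VarianceProxy q c v r) : 0 < c :=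
  h.q_pos.trans_le h.q_le

/-- One round on the input `y` does not increase the expected potential, if the direction `u` is
pulled back to `(1 - (2q/c) y yᵀ) u`. Rounds without a sign obey the same rule, because then the
state is transformed by the same contraction. -/
theorem VarianceProxy.expect_potential_le {q c v r : ℝ} (h : VarianceProxy q c v r) {y : E}
    (hy : ‖y‖ ≤ 1) {u : E} (hu : ‖u‖ ≤ r) :
    ∃ u' : E, ‖u'‖ ≤ r ∧ ∀ w : E,
      expect (binaryStep q c w y) (fun t => ENNReal.ofReal (potential v u t.1)) ≤
        ENNReal.ofReal (potential v u' w) := by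
  have hc := h.c_pos
  have hq := h.q_pos
  set s : ℝ := inner ℝ y u with hs
  set κ : ℝ := 2 * q / c * (1 - q / c) with hκ
  have hκ0 : 0 ≤ κ := mul_nonneg (by positivity) (sub_nonneg.2 ((div_le_one hc).2 h.q_le))
  set u' : E := u - (2 * q / c * s) • y with hu'
  have hnorm : ‖u'‖ ^ 2 ≤ ‖u‖ ^ 2 - 2 * κ * s ^ 2 := norm_sub_smul_inner_sq_le hc hy u
  have hle : ‖u'‖ ≤ ‖u‖ := by
    have : 0 ≤ 2 * κ * s ^ 2 := by positivity
    exact le_of_sq_le_sq (by linarith) (norm_nonneg u)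
  have hsr : |s| ≤ r := by
    refine (abs_real_inner_le_norm y u).trans (le_trans ?_ hu)
    exact mul_le_of_le_one_left (norm_nonneg _) hy
  refine ⟨u', hle.trans hu, fun w => ?_⟩
  have hwu : inner ℝ w u' = inner ℝ w u - 2 * q * (inner ℝ w y / c) * s := by
    rw [hu', inner_sub_right, inner_smul_right]; ring
  have hexp : Real.exp (-(v * ‖u‖ ^ 2 / 2)) * Real.exp (v * κ * s ^ 2) ≤
      Real.exp (-(v * ‖u'‖ ^ 2 / 2)) := by
    rw [← Real.exp_add]
    apply Real.exp_le_exp.2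
    nlinarith [mul_le_mul_of_nonneg_left hnorm h.v_nonneg]
  unfold binaryStep
  split_ifs with hfail
  · rw [expect_pure]
    apply ENNReal.ofReal_le_ofReal
    unfold potential
    have : inner ℝ (w - (2 * q * (inner ℝ w y / c)) • y) u = (inner ℝ w u' : ℝ) := by
      rw [hwu, inner_sub_left, inner_smul_left]; simp [hs]
    rw [this]
    have h1 : (1 : ℝ) ≤ Real.exp (v * κ * s ^ 2) :=
      Real.one_le_exp (by have := h.v_nonneg; positivity)
    have h2 := le_trans (le_mul_of_one_le_right (Real.exp_pos (-(v * ‖u‖ ^ 2 / 2))).le h1) hexp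
    have := Real.cosh_pos (inner ℝ w u')
    gcongr
  · set z : ℝ := inner ℝ w y / c with hz
    have hz1 : |z| ≤ 1 := by
      rw [hz, abs_div, abs_of_pos hc, div_le_one hc]; exact not_lt.1 hfail
    obtain ⟨hzl, hzr⟩ := abs_le.1 hz1
    have hq2 := h.q_le_half
    have hp0 : 0 ≤ q * (1 - z) := mul_nonneg hq.le (by linarith)
    have hp2 : q * (1 - z) ≤ 2 * q := by nlinarith
    rw [expect_map, show ((fun t : E × Option Bool => ENNReal.ofReal (potential v u t.1)) ∘
        fun b => (w + weightedSign q b • y, some b)) =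
        fun b => ENNReal.ofReal (potential v u (w + weightedSign q b • y)) from rfl,
      expect_coin hp0 (by linarith) _ fun b => potential_nonneg _ _ _]
    apply ENNReal.ofReal_le_ofReal
    set p : ℝ := q * (1 - z) with hp
    have hin : ∀ b, inner ℝ (w + weightedSign q b • y) u =
        (inner ℝ w u + weightedSign q b * s : ℝ) := fun b => by
      rw [inner_add_left, inner_smul_left]; simp [hs]
    -- With the drift split off, both exponentials in `cosh` see a centred coin.
    have hside : ∀ ε : ℝ, |ε * s| ≤ r →
        p * Real.exp (ε * (inner ℝ w u + 2 * (1 - q) * s)) +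
          (1 - p) * Real.exp (ε * (inner ℝ w u + -2 * q * s)) ≤
        Real.exp (ε * inner ℝ w u') * Real.exp (v * κ * (ε * s) ^ 2) := by
      intro ε hε
      refine le_trans (le_of_eq ?_)
        (mul_le_mul_of_nonneg_left (h.coin_le p (ε * s) hp0 hp2 hε) (Real.exp_pos _).le)
      have e1 : ε * (inner ℝ w u + 2 * (1 - q) * s) =
          ε * inner ℝ w u' + 2 * (1 - p) * (ε * s) := by rw [hwu, hp]; ring
      have e2 : ε * (inner ℝ w u + -2 * q * s) =
          ε * inner ℝ w u' + -(2 * p) * (ε * s) := by rw [hwu, hp]; ring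
      rw [e1, e2, Real.exp_add, Real.exp_add]
      ring
    have hplus := hside 1 (by simpa using hsr)
    have hminus := hside (-1) (by simpa using hsr)
    simp only [one_mul, neg_mul, neg_sq] at hplus hminus
    have hcosh : p * Real.cosh (inner ℝ w u + 2 * (1 - q) * s) +
        (1 - p) * Real.cosh (inner ℝ w u + -2 * q * s) ≤
        Real.exp (v * κ * s ^ 2) * Real.cosh (inner ℝ w u') := by
      simp only [Real.cosh_eq]
      simp only [neg_mul] at *
      linarith
    unfold potential
    rw [hin, hin]
    simp only [weightedSign, if_true, Bool.false_eq_true, if_false]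
    have hcp := Real.cosh_pos (inner ℝ w u')
    calc _ = Real.exp (-(v * ‖u‖ ^ 2 / 2)) * (p * Real.cosh (inner ℝ w u + 2 * (1 - q) * s) +
        (1 - p) * Real.cosh (inner ℝ w u + -2 * q * s)) := by ring
      _ ≤ Real.exp (-(v * ‖u‖ ^ 2 / 2)) *
          (Real.exp (v * κ * s ^ 2) * Real.cosh (inner ℝ w u')) := by gcongr
      _ = (Real.exp (-(v * ‖u‖ ^ 2 / 2)) * Real.exp (v * κ * s ^ 2)) *
          Real.cosh (inner ℝ w u') := by ring
      _ ≤ _ := by gcongr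

theorem potential_zero_le_one {v : ℝ} (hv : 0 ≤ v) (u : E) : potential v u 0 ≤ 1 := by
  unfold potential
  rw [inner_zero_left, Real.cosh_zero, mul_one, Real.exp_le_one_iff]
  have : 0 ≤ v * ‖u‖ ^ 2 / 2 := by positivity
  linarith

/-- Markov's inequality for the potential in direction `l • f`, `‖f‖ ≤ 1`. -/
theorem one_le_mul_potential {v l t : ℝ} (hv : 0 ≤ v) (hl : 0 ≤ l) {f w : E} (hf : ‖f‖ ≤ 1)
    (ht : t ≤ |inner ℝ w f|) :
    1 ≤ 2 * Real.exp (-(l * t) + v * l ^ 2 / 2) * potential v (l • f) w := by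
  have h1 : Real.exp (l * t) ≤ 2 * Real.cosh (inner ℝ w (l • f)) := by
    rw [← Real.cosh_abs, inner_smul_right, abs_mul, abs_of_nonneg hl, Real.cosh_eq]
    have : Real.exp (l * t) ≤ Real.exp (l * |inner ℝ w f|) :=
      Real.exp_le_exp.2 (mul_le_mul_of_nonneg_left ht hl)
    have := Real.exp_pos (-(l * |inner ℝ w f|))
    linarith
  have h2 : Real.exp (-(v * l ^ 2 / 2)) ≤ Real.exp (-(v * ‖l • f‖ ^ 2 / 2)) := by
    apply Real.exp_le_exp.2
    rw [norm_smul, Real.norm_eq_abs, abs_of_nonneg hl]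
    have : (l * ‖f‖) ^ 2 ≤ l ^ 2 := by
      apply pow_le_pow_left₀ (by positivity)
      exact mul_le_of_le_one_right hl hf
    nlinarith
  unfold potential
  calc (1 : ℝ) = Real.exp (-(l * t) + v * l ^ 2 / 2) *
        (Real.exp (-(v * l ^ 2 / 2)) * Real.exp (l * t)) := by
        rw [← Real.exp_add, ← Real.exp_add]; ring_nf; simp
    _ ≤ Real.exp (-(l * t) + v * l ^ 2 / 2) *
        (Real.exp (-(v * ‖l • f‖ ^ 2 / 2)) * (2 * Real.cosh (inner ℝ w (l • f)))) := by gcongr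
    _ = _ := by ring

end

section

variable {E : Type}

/-! ### Runs with idle rounds -/

/-- One round of a machine with states `S`, where the input `none` stands for an idle round. -/
def feed {S O : Type} (step : E → S → PMF (S × Option O)) : Option E → S → PMF (S × Option O)
  | none, s => PMF.pure (s, none)
  | some y, s => step y s

/-- The law of the outputs of a machine on a fixed sequence of inputs, with idle rounds. -/
def run {S O : Type} (step : E → S → PMF (S × Option O)) :
    (n : ℕ) → (Fin n → Option E) → S → PMF (Fin n → Option O)
  | 0, _, _ => PMF.pure Fin.elim0
  | n + 1, x, s =>
    (feed step (x 0) s).bind fun t =>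
      (run step n (fun i => x i.succ) t.1).map fun a => (Fin.cons t.2 a : Fin (n + 1) → Option O)

theorem run_succ_toOuterMeasure {S O : Type} (step : E → S → PMF (S × Option O)) {n : ℕ}
    (x : Fin (n + 1) → Option E) (s : S) (B : Set (Fin (n + 1) → Option O)) :
    (run step (n + 1) x s).toOuterMeasure B =
      expect (feed step (x 0) s) fun t =>
        (run step n (fun i => x i.succ) t.1).toOuterMeasure
          {a | (Fin.cons t.2 a : Fin (n + 1) → Option O) ∈ B} := by
  rw [run, PMF.toOuterMeasure_bind_apply]
  simp only [PMF.toOuterMeasure_map_apply]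
  rfl

variable [NormedAddCommGroup E] [InnerProductSpace ℝ E]

theorem assignAll_eq_run {β : Type} (c : ℝ → ℝ) (n : ℕ) (x : Fin n → E) (s : Balancers E β) :
    assignAll c n x s = run (assignStep c) n (fun i => some (x i)) s := by
  induction n generalizing s with
  | zero => rfl
  | succ n ih =>
    rw [assignAll, run]
    simp only [ih]
    rfl

theorem run_leaf {β : Type} (c : ℝ → ℝ) (n : ℕ) (x : Fin n → Option E) (b : β) :
    run (assignStep c) n x (.leaf b) = PMF.pure fun i => (x i).map fun _ => b := by
  induction n with
  | zero => rw [run]; congr 1; exact Subsingleton.elim _ _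
  | succ n ih =>
    have h : feed (assignStep c) (x 0) (.leaf b : Balancers E β) =
        PMF.pure (.leaf b, (x 0).map fun _ => b) := by
      cases x 0 <;> rfl
    rw [run, h, PMF.pure_bind, ih, PMF.pure_map]
    congr 1
    funext i
    refine Fin.cases rfl (fun j => rfl) i

/-- The inputs that are passed on to the child on side `b`, given the signs `s` of the node. -/
def route {n : ℕ} (b : Bool) (s : Fin n → Option Bool) (x : Fin n → Option E) :
    Fin n → Option E :=
  fun i => if s i = some b then x i else none

/-- The balancer at a node, as a machine. -/
def nodeStep (q c : ℝ) (y : E) (w : E) : PMF (E × Option Bool) := binaryStep q c w y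

/-- The assignment of all units, given those of the units sent to the left and to the right. -/
def merge {β : Type} {n : ℕ} (a b : Fin n → Option β) : Fin n → Option β :=
  fun i => (a i).or (b i)

theorem merge_cons {β : Type} {n : ℕ} (o₁ o₂ : Option β) (a b : Fin n → Option β) :
    merge (Fin.cons o₁ a : Fin (n + 1) → Option β) (Fin.cons o₂ b) =
      (Fin.cons (o₁.or o₂) (merge a b) : Fin (n + 1) → Option β) := by
  funext i
  refine Fin.cases rfl (fun j => rfl) i

/-- The run on a tree decouples: the balancer at the root can process the whole sequence first,
then the left subtree processes all that was routed to it, and then the right one. This turns the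
inputs of every single balancer into a fixed sequence. -/
theorem run_node {β : Type} (c : ℝ → ℝ) (n : ℕ) (x : Fin n → Option E) (q : ℝ) (w : E)
    (l r : Balancers E β) :
    run (assignStep c) n x (.node q w l r) =
      (run (nodeStep q (c q)) n x w).bind fun s =>
        (run (assignStep c) n (route true s x) l).bind fun a =>
          (run (assignStep c) n (route false s x) r).map fun b => merge a b := by
  induction n generalizing w l r with
  | zero =>
    simp only [run, PMF.pure_bind, PMF.pure_map]
    congr 1
    exact Subsingleton.elim _ _
  | succ n ih =>
    have hroute : ∀ (o : Option Bool) (s : Fin n → Option Bool) (b : Bool),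
        (fun i : Fin n => route b (Fin.cons o s : Fin (n + 1) → Option Bool) x i.succ) =
          route b s fun i => x i.succ := fun o s b => by
      funext i; simp [route]
    have hroute0 : ∀ (o : Option Bool) (s : Fin n → Option Bool) (b : Bool),
        route b (Fin.cons o s : Fin (n + 1) → Option Bool) x 0 =
          if o = some b then x 0 else none := fun o s b => by
      simp [route]
    simp only [run, PMF.bind_bind, PMF.bind_map, PMF.map_bind, PMF.map_comp, Function.comp_def,
      hroute, hroute0, merge_cons]
    rcases hx : x 0 with _ | y
    · simp [feed, ih, PMF.map_bind, PMF.map_comp, Function.comp_def]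
    · simp only [feed, nodeStep]
      rw [assignStep, PMF.bind_bind]
      congr 1
      funext ⟨w', o⟩
      rcases o with _ | _ | _
      · simp [ih, PMF.map_bind, PMF.map_comp, Function.comp_def]
      · simp only [PMF.bind_map, ih, PMF.map_bind, PMF.map_comp, Function.comp_def, if_false, if_true, PMF.pure_bind, Option.none_or, Option.some.injEq,
          Bool.false_eq_true]
        rw [PMF.bind_comm]
        congr 1
        funext s
        rw [PMF.bind_comm]
      · simp only [PMF.bind_map, ih, PMF.map_bind, PMF.map_comp, Function.comp_def, if_false, if_true, PMF.pure_bind, Option.or_none, Option.some.injEq,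
          Bool.true_eq_false]
        rw [PMF.bind_comm]

/-! ### Tail bounds for one balancer on a fixed sequence -/

/-- The scalar product with `f` of the term which a round adds to the state of a balancer. -/
def signedInner (q : ℝ) (f : E) : Option E → Option Bool → ℝ
  | some y, some b => weightedSign q b * inner ℝ y f
  | _, _ => 0

theorem VarianceProxy.expect_feed_potential_le {q c v r : ℝ} (h : VarianceProxy q c v r)
    {x : Option E} (hx : ∀ y, x = some y → ‖y‖ ≤ 1) {u : E} (hu : ‖u‖ ≤ r) :
    ∃ u' : E, ‖u'‖ ≤ r ∧ ∀ w : E,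
      expect (feed (nodeStep q c) x w) (fun t => ENNReal.ofReal (potential v u t.1)) ≤
        ENNReal.ofReal (potential v u' w) := by
  rcases x with _ | y
  · exact ⟨u, hu, fun w => by rw [feed, expect_pure]⟩
  · exact h.expect_potential_le (hx y rfl) hu

theorem toOuterMeasure_le_one {A : Type*} (p : PMF A) (B : Set A) : p.toOuterMeasure B ≤ 1 := by
  refine (p.toOuterMeasure.mono (Set.subset_univ B)).trans (le_of_eq ?_)
  exact (PMF.toOuterMeasure_apply_eq_one_iff _ _).2 (Set.subset_univ _)

/-- By the exponential Markov inequality, a given round is unlikely to produce no sign. -/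
theorem VarianceProxy.run_eq_none_le {q c v r l : ℝ} (h : VarianceProxy q c v r) (hl : 0 ≤ l)
    (hlr : l ≤ r) {n : ℕ} (x : Fin n → Option E) (hx : ∀ i y, x i = some y → ‖y‖ ≤ 1)
    (i : Fin n) (hi : x i ≠ none) :
    ∃ u' : E, ‖u'‖ ≤ r ∧ ∀ w : E,
      (run (nodeStep q c) n x w).toOuterMeasure {s | s i = none} ≤
        ENNReal.ofReal (2 * Real.exp (-(l * c) + v * l ^ 2 / 2)) *
          ENNReal.ofReal (potential v u' w) := by
  induction n with
  | zero => exact i.elim0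
  | succ n ih =>
    revert hi
    refine Fin.cases (fun hi => ?_) (fun i hi => ?_) i
    · obtain ⟨y, hy⟩ := Option.ne_none_iff_exists'.1 hi
      have hy1 := hx 0 y hy
      refine ⟨l • y, ?_, fun w => ?_⟩
      · rw [norm_smul, Real.norm_eq_abs, abs_of_nonneg hl]
        exact (mul_le_of_le_one_right hl hy1).trans hlr
      by_cases hc : c < |inner ℝ w y|
      · refine (toOuterMeasure_le_one _ _).trans ?_
        rw [← ENNReal.ofReal_mul (by positivity), ← ENNReal.ofReal_one]
        exact ENNReal.ofReal_le_ofReal (one_le_mul_potential h.v_nonneg hl hy1 hc.le)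
      · rw [run_succ_toOuterMeasure, hy, feed, nodeStep, binaryStep, if_neg hc, expect_map]
        simp [expect]
    · obtain ⟨u₁, hu₁, h₁⟩ := ih (fun i => x i.succ) (fun i => hx i.succ) i hi
      obtain ⟨u₂, hu₂, h₂⟩ := h.expect_feed_potential_le (hx 0) hu₁
      refine ⟨u₂, hu₂, fun w => ?_⟩
      rw [run_succ_toOuterMeasure]
      refine (expect_mono _ fun t => ?_).trans ((expect_const_mul _ _ _).trans_le
        (mul_le_mul_right (h₂ w) _))
      simpa using h₁ t.1

/-- As long as every round produces a sign, the final state is the signed sum of the inputs; this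
sum is unlikely to be large in a given direction. -/
theorem VarianceProxy.run_signedInner_le {q c v r l t : ℝ} (h : VarianceProxy q c v r)
    (hl : 0 ≤ l) (hlr : l ≤ r) {f : E} (hf : ‖f‖ ≤ 1) {n : ℕ} (x : Fin n → Option E)
    (hx : ∀ i y, x i = some y → ‖y‖ ≤ 1) :
    ∃ u' : E, ‖u'‖ ≤ r ∧ ∀ w : E,
      (run (nodeStep q c) n x w).toOuterMeasure
          {s | (∀ i, x i ≠ none → s i ≠ none) ∧
            t ≤ |inner ℝ w f + ∑ i, signedInner q f (x i) (s i)|} ≤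
        ENNReal.ofReal (2 * Real.exp (-(l * t) + v * l ^ 2 / 2)) *
          ENNReal.ofReal (potential v u' w) := by
  induction n with
  | zero =>
    refine ⟨l • f, ?_, fun w => ?_⟩
    · rw [norm_smul, Real.norm_eq_abs, abs_of_nonneg hl]
      exact (mul_le_of_le_one_right hl hf).trans hlr
    by_cases ht : t ≤ |inner ℝ w f|
    · refine (toOuterMeasure_le_one _ _).trans ?_
      rw [← ENNReal.ofReal_mul (by positivity), ← ENNReal.ofReal_one]
      exact ENNReal.ofReal_le_ofReal (one_le_mul_potential h.v_nonneg hl hf ht)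
    · simp [ht]
  | succ n ih =>
    obtain ⟨u₁, hu₁, h₁⟩ := ih (fun i => x i.succ) (fun i => hx i.succ)
    obtain ⟨u₂, hu₂, h₂⟩ := h.expect_feed_potential_le (hx 0) hu₁
    refine ⟨u₂, hu₂, fun w => ?_⟩
    refine le_trans ?_ ((expect_const_mul _ _ _).trans_le (mul_le_mul_right (h₂ w) _))
    rw [run_succ_toOuterMeasure]
    simp only [Set.mem_ofPred_eq, Fin.forall_fin_succ, Fin.sum_univ_succ, Fin.cons_zero,
      Fin.cons_succ]
    rcases hx0 : x 0 with _ | y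
    · rw [feed, expect_pure, expect_pure]
      simpa [signedInner] using h₁ w
    · simp only [feed, nodeStep, binaryStep]
      split_ifs with hc
      · rw [expect_pure, expect_pure]
        simp
      · rw [expect_map, expect_map]
        refine expect_mono _ fun b => ?_
        have := h₁ (w + weightedSign q b • y)
        rw [inner_add_left, inner_smul_left] at this
        simpa [signedInner, add_assoc] using this

/-- The event that a balancer with inputs `x` produced a sign in every round that is not idle, and
that its final state is at most `t` in the directions `f j`. -/
def SignsGood {ι : Type} (q t : ℝ) (f : ι → E) {n : ℕ} (x : Fin n → Option E)
    (s : Fin n → Option Bool) : Prop :=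
  (∀ i, x i ≠ none → s i ≠ none) ∧ ∀ j, |∑ i, signedInner q (f j) (x i) (s i)| ≤ t

theorem VarianceProxy.run_not_signsGood_le {ι : Type} [Fintype ι] {q c v r l₁ l₂ t : ℝ}
    (h : VarianceProxy q c v r) (hl₁ : 0 ≤ l₁) (hlr₁ : l₁ ≤ r) (hl₂ : 0 ≤ l₂) (hlr₂ : l₂ ≤ r)
    {f : ι → E} (hf : ∀ j, ‖f j‖ ≤ 1) {n : ℕ} (x : Fin n → Option E)
    (hx : ∀ i y, x i = some y → ‖y‖ ≤ 1) :
    (run (nodeStep q c) n x 0).toOuterMeasure {s | ¬ SignsGood q t f x s} ≤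
      n * ENNReal.ofReal (2 * Real.exp (-(l₁ * c) + v * l₁ ^ 2 / 2)) +
        Fintype.card ι * ENNReal.ofReal (2 * Real.exp (-(l₂ * t) + v * l₂ ^ 2 / 2)) := by
  have hpot : ∀ (K : ℝ≥0∞) (u : E), K * ENNReal.ofReal (potential v u 0) ≤ K := fun K u => by
    refine mul_le_of_le_one_right' ?_
    rw [← ENNReal.ofReal_one]
    exact ENNReal.ofReal_le_ofReal (potential_zero_le_one h.v_nonneg u)
  set A : Fin n → Set (Fin n → Option Bool) := fun i => {s | x i ≠ none ∧ s i = none}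
  set D : ι → Set (Fin n → Option Bool) := fun j => {s | (∀ i, x i ≠ none → s i ≠ none) ∧
    t ≤ |inner ℝ (0 : E) (f j) + ∑ i, signedInner q (f j) (x i) (s i)|}
  have hsub : {s | ¬ SignsGood q t f x s} ⊆ (⋃ i, A i) ∪ ⋃ j, D j := by
    intro s hs
    simp only [SignsGood, Set.mem_ofPred_eq, not_and_or, not_forall] at hs
    by_cases hall : ∀ i, x i ≠ none → s i ≠ none
    · right
      rcases hs with ⟨i, hi, hsi⟩ | ⟨j, hj⟩
      · exact absurd (hall i hi) hsi
      · refine Set.mem_iUnion.2 ⟨j, hall, ?_⟩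
        rw [inner_zero_left, zero_add]
        exact (not_le.1 hj).le
    · left
      push Not at hall
      obtain ⟨i, hi⟩ := hall
      exact Set.mem_iUnion.2 ⟨i, hi⟩
  refine (MeasureTheory.measure_mono hsub).trans ((MeasureTheory.measure_union_le _ _).trans ?_)
  refine add_le_add ((MeasureTheory.measure_iUnion_fintype_le _ _).trans ?_)
    ((MeasureTheory.measure_iUnion_fintype_le _ _).trans ?_)
  · refine (Finset.sum_le_card_nsmul _ _ _ fun i _ => ?_).trans_eq
      (by rw [Finset.card_univ, Fintype.card_fin, nsmul_eq_mul])
    by_cases hi : x i = none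
    · simp [A, hi]
    · obtain ⟨u, -, hu⟩ := h.run_eq_none_le hl₁ hlr₁ x hx i hi
      exact (MeasureTheory.measure_mono fun s hs => hs.2).trans ((hu 0).trans (hpot _ _))
  · refine (Finset.sum_le_card_nsmul _ _ _ fun j _ => ?_).trans_eq
      (by rw [Finset.card_univ, nsmul_eq_mul])
    obtain ⟨u, -, hu⟩ := h.run_signedInner_le (t := t) hl₂ hlr₂ (hf j) x hx
    exact (hu 0).trans (hpot _ _)

end

section

/-! ### Union bound over the tree -/

namespace BinTree

variable {β : Type}

/-- The number of internal nodes. -/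
def numNodes : BinTree β → ℕ
  | leaf _ => 0
  | node l r => numNodes l + numNodes r + 1

/-- The largest number of internal nodes on a path from the root to a leaf. -/
def depth : BinTree β → ℕ
  | leaf _ => 0
  | node l r => max (depth l) (depth r) + 1

theorem length_leaves (T : BinTree β) : T.leaves.length = T.numNodes + 1 := by
  induction T with
  | leaf => rfl
  | node l r hl hr => simp only [leaves, List.length_append, numNodes, hl, hr]; omega

theorem weight_pos {α : β → ℝ} (hα : ∀ m, 0 < α m) (T : BinTree β) : 0 < T.weight α := by
  induction T with
  | leaf b => exact hα b
  | node l r hl hr => exact add_pos hl hr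

theorem le_weight {α : β → ℝ} (hα : ∀ m, 0 < α m) {T : BinTree β} {m : β} (hm : m ∈ T.leaves) :
    α m ≤ T.weight α := by
  induction T with
  | leaf b => simp only [leaves, List.mem_singleton] at hm; simp [weight, hm]
  | node l r hl hr =>
    have h1 := l.weight_pos hα
    have h2 := r.weight_pos hα
    simp only [leaves, List.mem_append] at hm
    simp only [weight]
    rcases hm with hm | hm
    · linarith [hl hm]
    · linarith [hr hm]

end BinTree

variable {E : Type} [NormedAddCommGroup E] [InnerProductSpace ℝ E]

/-- The scalar product with `f` of an input, which is `0` for an idle round. -/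
def inputInner (f : E) : Option E → ℝ
  | some y => inner ℝ y f
  | none => 0

/-- The assignment `a` of the inputs `x` to the leaves of `T` is balanced: all inputs are assigned,
and in the directions `f j` the sum at each leaf differs from its proportional share of the total by
at most `t / 2` for every level of the tree. -/
def TreeGood {β ι : Type} [DecidableEq β] (α : β → ℝ) (t : ℝ) (f : ι → E) {n : ℕ} (T : BinTree β)
    (x : Fin n → Option E) (a : Fin n → Option β) : Prop :=
  (∀ i, x i = none → a i = none) ∧ (∀ i, x i ≠ none → ∃ m ∈ T.leaves, a i = some m) ∧
    ∀ m ∈ T.leaves, ∀ j,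
      |(∑ i, if a i = some m then inputInner (f j) (x i) else 0) -
        α m / T.weight α * ∑ i, inputInner (f j) (x i)| ≤ T.depth * (t / 2)

theorem sum_signedInner_eq {n : ℕ} (q : ℝ) (f : E) (x : Fin n → Option E)
    (s : Fin n → Option Bool) :
    ∑ i, signedInner q f (x i) (s i) =
      2 * (1 - q) * ∑ i, inputInner f (route true s x i) -
        2 * q * ∑ i, inputInner f (route false s x i) := by
  rw [Finset.mul_sum, Finset.mul_sum, ← Finset.sum_sub_distrib]
  refine Finset.sum_congr rfl fun i _ => ?_
  rcases hx : x i with _ | y <;> rcases hs : s i with _ | _ | _ <;>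
    simp [signedInner, route, inputInner, weightedSign, hx, hs]

theorem sum_inputInner_route {n : ℕ} (f : E) (x : Fin n → Option E)
    (s : Fin n → Option Bool) (hs : ∀ i, x i ≠ none → s i ≠ none) :
    ∑ i, inputInner f (x i) =
      ∑ i, inputInner f (route true s x i) + ∑ i, inputInner f (route false s x i) := by
  rw [← Finset.sum_add_distrib]
  refine Finset.sum_congr rfl fun i _ => ?_
  have := hs i
  rcases hx : x i with _ | y <;> rcases hs : s i with _ | _ | _ <;>
    simp_all [route, inputInner]

/-- Passing from a node to its child of relative weight `p` adds half of the discrepancy `V` at the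
node to the deviation of a leaf from its share. -/
theorem abs_sub_share_le {S S₁ P a w₁ w V D t : ℝ} (ha : 0 < a) (haw : a ≤ w₁) (hw : 0 < w)
    (h₁ : |P - a / w₁ * S₁| ≤ D) (hV : S₁ - w₁ / w * S = V) (ht : |V| ≤ t / 2) :
    |P - a / w * S| ≤ D + t / 2 := by
  have hw₁ : 0 < w₁ := ha.trans_le haw
  have e : P - a / w * S = (P - a / w₁ * S₁) + a / w₁ * V := by
    rw [← hV]; field_simp; ring
  have h2 : |a / w₁ * V| ≤ t / 2 := by
    rw [abs_mul, abs_of_pos (div_pos ha hw₁)]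
    exact (mul_le_of_le_one_left (abs_nonneg _) ((div_le_one hw₁).2 haw)).trans ht
  rw [e]
  exact (abs_add_le _ _).trans (add_le_add h₁ h2)

theorem TreeGood.node {β ι : Type} [DecidableEq β] {α : β → ℝ} (hα : ∀ m, 0 < α m) {t : ℝ}
    {f : ι → E} {n : ℕ} {l r : BinTree β} (hnd : (BinTree.node l r).leaves.Nodup)
    {x : Fin n → Option E} {s : Fin n → Option Bool} {a b : Fin n → Option β}
    (hs : SignsGood (l.weight α / (l.weight α + r.weight α)) t f x s)
    (ha : TreeGood α t f l (route true s x) a) (hb : TreeGood α t f r (route false s x) b) :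
    TreeGood α t f (.node l r) x (merge a b) := by
  obtain ⟨hs1, hs2⟩ := hs
  obtain ⟨ha1, ha2, ha3⟩ := ha
  obtain ⟨hb1, hb2, hb3⟩ := hb
  have hdisj : ∀ m ∈ l.leaves, m ∉ r.leaves := fun m hl hr =>
    (List.nodup_append.1 hnd).2.2 m hl m hr rfl
  have hal : ∀ i m, a i = some m → m ∈ l.leaves ∧ s i = some true ∧ b i = none := by
    intro i m h
    have h1 : route true s x i ≠ none := fun h0 => by simp [ha1 i h0] at h
    obtain ⟨m', hm', h2⟩ := ha2 i h1
    have h3 : s i = some true := by by_contra h4; exact h1 (by simp [route, h4])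
    refine ⟨?_, h3, hb1 i (by simp [route, h3])⟩
    rw [h] at h2; rwa [Option.some.inj h2]
  have hbr : ∀ i m, b i = some m → m ∈ r.leaves ∧ s i = some false ∧ a i = none := by
    intro i m h
    have h1 : route false s x i ≠ none := fun h0 => by simp [hb1 i h0] at h
    obtain ⟨m', hm', h2⟩ := hb2 i h1
    have h3 : s i = some false := by by_contra h4; exact h1 (by simp [route, h4])
    refine ⟨?_, h3, ha1 i (by simp [route, h3])⟩
    rw [h] at h2; rwa [Option.some.inj h2]
  refine ⟨fun i hi => ?_, fun i hi => ?_, fun m hm j => ?_⟩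
  · have : ∀ c, route c s x i = none := fun c => by simp [route, hi]
    simp [merge, ha1 i (this _), hb1 i (this _)]
  · rcases hsi : s i with _ | _ | _
    · exact absurd hsi (hs1 i hi)
    · obtain ⟨m, hm, hbm⟩ := hb2 i (by simpa [route, hsi] using hi)
      refine ⟨m, by simp [BinTree.leaves, hm], ?_⟩
      simp [merge, hbm, (hbr i m hbm).2.2]
    · obtain ⟨m, hm, ham⟩ := ha2 i (by simpa [route, hsi] using hi)
      exact ⟨m, by simp [BinTree.leaves, hm], by simp [merge, ham]⟩
  · have hl := l.weight_pos hα
    have hr := r.weight_pos hα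
    set S := ∑ i, inputInner (f j) (x i) with hS
    set S₁ := ∑ i, inputInner (f j) (route true s x i) with hS₁
    set S₂ := ∑ i, inputInner (f j) (route false s x i) with hS₂
    have hsum : S = S₁ + S₂ := sum_inputInner_route (f j) x s hs1
    have hV := sum_signedInner_eq (l.weight α / (l.weight α + r.weight α)) (f j) x s
    have hVt := hs2 j
    set V := ∑ i, signedInner (l.weight α / (l.weight α + r.weight α)) (f j) (x i) (s i)
    have hVt2 : |V / 2| ≤ t / 2 := by rw [abs_div, abs_two]; linarith
    have ht : 0 ≤ t := (abs_nonneg _).trans hVt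
    simp only [BinTree.leaves, List.mem_append] at hm
    simp only [BinTree.weight, BinTree.depth]
    push_cast
    rcases hm with hm | hm
    · have hP : (∑ i, if merge a b i = some m then inputInner (f j) (x i) else 0) =
          ∑ i, if a i = some m then inputInner (f j) (route true s x i) else 0 := by
        refine Finset.sum_congr rfl fun i _ => ?_
        by_cases h : a i = some m
        · have h' := (hal i m h).2.1
          simp [merge, h, route, h']
        · rw [if_neg h, if_neg]
          rcases hai : a i with _ | m'
          · simp only [merge, hai, Option.none_or]
            exact fun h' => hdisj m hm (hbr i m h').1
          · simpa [merge, hai] using h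
      rw [hP]
      refine (abs_sub_share_le (hα m) (BinTree.le_weight hα hm) (add_pos hl hr) (ha3 m hm j)
        (V := V / 2) ?_ hVt2).trans ?_
      · rw [hV, hsum]; field_simp; ring
      · have : (l.depth : ℝ) ≤ max (l.depth : ℝ) r.depth := le_max_left _ _
        nlinarith
    · have hP : (∑ i, if merge a b i = some m then inputInner (f j) (x i) else 0) =
          ∑ i, if b i = some m then inputInner (f j) (route false s x i) else 0 := by
        refine Finset.sum_congr rfl fun i _ => ?_
        by_cases h : b i = some m
        · have h' := (hbr i m h).2
          simp [merge, h, route, h'.1, h'.2]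
        · rw [if_neg h, if_neg]
          rcases hai : a i with _ | m'
          · simpa [merge, hai] using h
          · simp only [merge, hai, Option.some_or, Option.some.injEq]
            rintro rfl
            exact hdisj m' (hal i m' hai).1 hm
      rw [hP]
      refine (abs_sub_share_le (hα m) (BinTree.le_weight hα hm) (add_pos hl hr) (hb3 m hm j)
        (V := -(V / 2)) ?_ (by rwa [abs_neg])).trans ?_
      · rw [hV, hsum]; field_simp; ring
      · have : (r.depth : ℝ) ≤ max (l.depth : ℝ) r.depth := le_max_right _ _
        nlinarith

theorem toOuterMeasure_bind_le {A B : Type*} (p : PMF A) (g : A → PMF B) (G : Set A) (S : Set B)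
    (ε : ℝ≥0∞) (h : ∀ a ∈ G, (g a).toOuterMeasure S ≤ ε) :
    (p.bind g).toOuterMeasure S ≤ p.toOuterMeasure Gᶜ + ε := by
  rw [PMF.toOuterMeasure_bind_apply, PMF.toOuterMeasure_apply]
  calc ∑' a, p a * (g a).toOuterMeasure S
      ≤ ∑' a, (Gᶜ.indicator (fun a => p a) a + p a * ε) := by
        refine ENNReal.tsum_le_tsum fun a => ?_
        by_cases ha : a ∈ G
        · exact (mul_le_mul_right (h a ha) _).trans le_add_self
        · rw [Set.indicator_of_mem (show a ∈ Gᶜ from ha)]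
          exact (mul_le_of_le_one_right' (toOuterMeasure_le_one _ _)).trans le_self_add
    _ = _ := by rw [ENNReal.tsum_add, ENNReal.tsum_mul_right, p.tsum_coe, one_mul]

/-- If every balancer fails with probability at most `ε` on every fixed sequence of inputs, then the
tree fails with probability at most `ε` times the number of its balancers. -/
theorem run_not_treeGood_le {β ι : Type} [DecidableEq β] {α : β → ℝ} (hα : ∀ m, 0 < α m)
    {c : ℝ → ℝ} {t : ℝ} {f : ι → E} {n : ℕ} {ε : ℝ≥0∞}
    (hnode : ∀ q, 0 < q → q ≤ 1 / 2 → ∀ x : Fin n → Option E, (∀ i y, x i = some y → ‖y‖ ≤ 1) →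
      (run (nodeStep q (c q)) n x 0).toOuterMeasure {s | ¬ SignsGood q t f x s} ≤ ε)
    (T : BinTree β) (hT : T.LighterLeft α) (hnd : T.leaves.Nodup) (x : Fin n → Option E)
    (hx : ∀ i y, x i = some y → ‖y‖ ≤ 1) :
    (run (assignStep c) n x (initialState E α T)).toOuterMeasure {a | ¬ TreeGood α t f T x a} ≤
      T.numNodes * ε := by
  induction T generalizing x with
  | leaf b =>
    have hb := hα b
    rw [initialState, run_leaf]
    have hgood : TreeGood α t f (.leaf b) x fun i => (x i).map fun _ => b := by
      refine ⟨fun i hi => by simp [hi], fun i hi => ?_, fun m hm j => ?_⟩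
      · obtain ⟨y, hy⟩ := Option.ne_none_iff_exists'.1 hi
        exact ⟨b, by simp [BinTree.leaves], by simp [hy]⟩
      · simp only [BinTree.leaves, List.mem_singleton] at hm
        subst hm
        have : ∀ i, (if (x i).map (fun _ => m) = some m then inputInner (f j) (x i) else 0) =
            inputInner (f j) (x i) := fun i => by
          rcases x i with _ | y <;> simp [inputInner]
        simp only [this, BinTree.weight, BinTree.depth]
        rw [div_self hb.ne']
        simp
    rw [PMF.toOuterMeasure_pure_apply, if_neg (by simpa using hgood)]
    exact zero_le
  | node l r ihl ihr =>
    obtain ⟨hlr, hl, hr⟩ := hT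
    have hwl := l.weight_pos hα
    have hwr := r.weight_pos hα
    have hnd' := List.nodup_append.1 hnd
    have hroute : ∀ b s i y, route b s x i = some y → ‖y‖ ≤ 1 := by
      intro b s i y h
      refine hx i y ?_
      unfold route at h
      split_ifs at h
      exact h
    set q := l.weight α / (l.weight α + r.weight α) with hq
    have hq0 : 0 < q := by positivity
    have hq2 : q ≤ 1 / 2 := by rw [hq, div_le_iff₀ (by positivity)]; linarith
    rw [initialState, run_node]
    refine (toOuterMeasure_bind_le _ _ {s | SignsGood q t f x s} _
      (l.numNodes * ε + r.numNodes * ε) fun s hs => ?_).trans ?_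
    · refine (toOuterMeasure_bind_le _ _ {a | TreeGood α t f l (route true s x) a} _
        (r.numNodes * ε) fun a ha => ?_).trans ?_
      · rw [PMF.toOuterMeasure_map_apply]
        refine (MeasureTheory.measure_mono ?_).trans (ihr hr hnd'.2.1 _ (hroute false s))
        intro b hb hgood
        exact hb (TreeGood.node hα hnd hs ha hgood)
      · exact add_le_add_left (ihl hl hnd'.1 _ (hroute true s)) _
    · refine (add_le_add_left (hnode q hq0 hq2 x hx) _).trans (le_of_eq ?_)
      simp only [BinTree.numNodes]
      push_cast
      ring

end

section

/-! ### Parameters of the balancers -/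

/-- The variance of the state of a balancer is of the order of its threshold. For `q` bounded away
from `0` Hoeffding's lemma serves in all directions. For small `q` it would lose a factor `1/q`;
there the bound for biased coins serves, at the price of short directions. The last inequality
makes a round without a sign as unlikely as `exp (-L)`. -/
theorem exists_varianceProxy {q L : ℝ} (hq : 0 < q) (hq2 : q ≤ 1 / 2) (hL : 1 ≤ L) :
    ∃ v r l, VarianceProxy q (min (1 / q) 9.3 * L) v r ∧ 0 ≤ l ∧ l ≤ r ∧ 1 / 4 ≤ r ∧
      v ≤ 47 * L ∧ -(l * (min (1 / q) 9.3 * L)) + v * l ^ 2 / 2 ≤ -L := by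
  have hL0 : 0 < L := by linarith
  rcases le_total (1 / q) 9.3 with h | h
  · rw [min_eq_left h]
    set c := 1 / q * L with hc
    have hcL : c * q = L := by rw [hc]; field_simp
    have hc0 : 0 < c := by positivity
    have hqc : q / c ≤ 1 / 2 := by rw [div_le_iff₀ hc0]; nlinarith
    have hq93 : 1 ≤ 9.3 * q := by rwa [div_le_iff₀ hq] at h
    have hv : c / (2 * q) * (2 * q / c) = 1 := by field_simp
    refine ⟨c / (2 * q), 1, 2 * q, ⟨hq, hq2, ?_, by positivity, ?_⟩, by linarith, by linarith,
      by norm_num, ?_, ?_⟩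
    · rw [div_le_iff₀ hc0] at hqc; linarith
    · intro p s hp0 hp2 hs
      refine (centred_coin_le_exp_half hp0 (by linarith) s).trans (Real.exp_le_exp.2 ?_)
      rw [← mul_assoc, hv]
      nlinarith [sq_nonneg s]
    · rw [div_le_iff₀ (by positivity), hc, div_mul_eq_mul_div, div_le_iff₀ hq]
      nlinarith [mul_le_mul hq93 hq93 zero_le_one (by positivity)]
    · have : c / (2 * q) * (2 * q) ^ 2 / 2 = L := by rw [← hcL]; field_simp
      rw [this]; linarith
  · rw [min_eq_right h]
    set c : ℝ := 9.3 * L with hc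
    have hc0 : 0 < c := by positivity
    have hq93 : 9.3 * q ≤ 1 := by rwa [le_div_iff₀ hq] at h
    have hqc : q / c ≤ 1 / 21 := by rw [div_le_iff₀ hc0]; linarith
    have hv : 4.2 * c * (2 * q / c) = 8.4 * q := by field_simp; norm_num
    refine ⟨4.2 * c, 1 / 4, 1 / 4, ⟨hq, hq2, by linarith, by positivity, ?_⟩, by norm_num, le_rfl,
      le_rfl, by linarith, by linarith⟩
    intro p s hp0 hp2 hs
    refine (centred_coin_le_exp_bias hp0 hp2 (by linarith)).trans (Real.exp_le_exp.2 ?_)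
    rw [← mul_assoc, hv]
    have : 8 * q ≤ 8.4 * q * (1 - q / c) := by nlinarith
    nlinarith [sq_nonneg s]

/-- The bound on the coordinates of the state of a balancer. -/
def stateBound (n d k : ℕ) (δ : ℝ) : ℝ :=
  36 * Real.sqrt (d * Real.log (d * k / δ) * Real.log (n * k / δ))

/-- The optimal Gaussian direction is of length about `√(log (dk/δ) / log (nk/δ))`; when this is too
long, the factor `√d` in `stateBound` makes up for using a direction of length `1/4` instead. -/
theorem exists_state_tail_le {n d k : ℕ} {δ v : ℝ} (hn : 1 ≤ n) (hk : 2 ≤ k) (h0 : 0 < δ)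
    (h1 : δ < 1) (hv : v ≤ 94 * Real.log (n * k / δ)) :
    ∃ l, 0 ≤ l ∧ l ≤ 1 / 4 ∧
      d * (2 * Real.exp (-(l * stateBound n d k δ) + v * l ^ 2 / 2)) ≤ δ / k ^ 2 := by
  rcases Nat.eq_zero_or_pos d with rfl | hd
  · exact ⟨0, le_rfl, by norm_num, by simp; positivity⟩
  have hn' : (1 : ℝ) ≤ n := by exact_mod_cast hn
  have hd' : (1 : ℝ) ≤ d := by exact_mod_cast hd
  have hk' : (2 : ℝ) ≤ k := by exact_mod_cast hk
  set M := Real.log (n * k / δ) with hM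
  set H := Real.log (d * k / δ) with hH
  have hdk : 2 ≤ d * k / δ := by rw [le_div_iff₀ h0]; nlinarith
  have hkδ : 2 ≤ k / δ := by rw [le_div_iff₀ h0]; nlinarith
  have hnk : k / δ ≤ n * k / δ := by gcongr; nlinarith
  have hlog2 := Real.log_two_gt_d9
  have hMk : Real.log (k / δ) ≤ M := Real.log_le_log (by linarith) hnk
  have hM2 : 1 / 2 ≤ M := by
    have := Real.log_le_log two_pos (hkδ.trans hnk); linarith
  have hH2 : 0 < H := by
    have := Real.log_le_log two_pos hdk; linarith
  have hHd : H ≤ 2 * (d * M) := by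
    have e : H = Real.log d + Real.log (k / δ) := by
      rw [hH, mul_div_assoc, Real.log_mul (by positivity) (by positivity)]
    have := Real.log_le_sub_one_of_pos (show (0 : ℝ) < d by linarith)
    nlinarith
  -- An exponent `-3 H` suffices.
  suffices h : ∃ l, 0 ≤ l ∧ l ≤ 1 / 4 ∧ 3 * H ≤ l * stateBound n d k δ - v * l ^ 2 / 2 by
    obtain ⟨l, hl0, hl1, hl⟩ := h
    refine ⟨l, hl0, hl1, ?_⟩
    have e : Real.exp (-(l * stateBound n d k δ) + v * l ^ 2 / 2) ≤ (δ / (d * k)) ^ 3 := by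
      have e2 : (δ / (d * k)) ^ 3 = Real.exp (-(3 * H)) := by
        rw [hH, ← inv_div, inv_pow, Real.exp_neg, mul_comm 3, Real.exp_mul,
          Real.exp_log (by linarith)]
        norm_cast
      rw [e2]; exact Real.exp_le_exp.2 (by linarith)
    calc d * (2 * Real.exp (-(l * stateBound n d k δ) + v * l ^ 2 / 2))
        ≤ d * (2 * (δ / (d * k)) ^ 3) := by gcongr
      _ = δ / k ^ 2 * (2 * δ ^ 2 / (d ^ 2 * k)) := by field_simp
      _ ≤ δ / k ^ 2 * 1 := by
        refine mul_le_mul_of_nonneg_left ((div_le_one (by positivity)).2 ?_) (by positivity)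
        have : δ ^ 2 ≤ 1 := by nlinarith
        have : (1 : ℝ) ≤ d ^ 2 := by nlinarith
        nlinarith
      _ = δ / k ^ 2 := mul_one _
  unfold stateBound
  rcases le_total H M with h | h
  · refine ⟨1 / 4 * Real.sqrt (H / M), by positivity, ?_, ?_⟩
    · have : Real.sqrt (H / M) ≤ 1 := Real.sqrt_le_one.2 ((div_le_one (by linarith)).2 h)
      linarith
    · have e1 : H ≤ Real.sqrt (H / M) * Real.sqrt (d * H * M) := by
        rw [← Real.sqrt_mul (by positivity)]
        apply Real.le_sqrt_of_sq_le
        have : H / M * (d * H * M) = d * H ^ 2 := by field_simp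
        rw [this]
        nlinarith [sq_nonneg H]
      have e2 : v * (1 / 4 * Real.sqrt (H / M)) ^ 2 / 2 ≤ 3 * H := by
        rw [mul_pow, Real.sq_sqrt (by positivity)]
        calc v * ((1 / 4) ^ 2 * (H / M)) / 2 ≤ (94 * M) * ((1 / 4) ^ 2 * (H / M)) / 2 := by gcongr
          _ = 47 / 16 * H := by field_simp; norm_num
          _ ≤ 3 * H := by linarith
      linarith
  · refine ⟨1 / 4, by norm_num, le_rfl, ?_⟩
    have e1 : 6 * H ≤ 9 * Real.sqrt (d * H * M) := by
      have : 2 / 3 * H ≤ Real.sqrt (d * H * M) := by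
        apply Real.le_sqrt_of_sq_le
        nlinarith
      linarith
    linarith

/-- The failure probability `δ / k` per balancer of the thresholds and `δ / k ^ 2` for the size of
the states. -/
theorem run_not_signsGood_threshold_le {E : Type} [NormedAddCommGroup E] [InnerProductSpace ℝ E]
    {n d k : ℕ} {δ q : ℝ} (hn : 1 ≤ n) (hk : 2 ≤ k) (h0 : 0 < δ) (h1 : δ < 1) (hq : 0 < q)
    (hq2 : q ≤ 1 / 2) {f : Fin d → E} (hf : ∀ j, ‖f j‖ ≤ 1) (x : Fin n → Option E)
    (hx : ∀ i y, x i = some y → ‖y‖ ≤ 1) :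
    (run (nodeStep q (threshold n (δ / k) q)) n x 0).toOuterMeasure
        {s | ¬ SignsGood q (stateBound n d k δ) f x s} ≤
      ENNReal.ofReal (δ / k + δ / k ^ 2) := by
  have hn' : (1 : ℝ) ≤ n := by exact_mod_cast hn
  have hk' : (2 : ℝ) ≤ k := by exact_mod_cast hk
  have hnk : 2 ≤ n * k / δ := by rw [le_div_iff₀ h0]; nlinarith
  set L := Real.log (2 * n / (δ / k)) with hL
  have hlog2 := Real.log_two_gt_d9
  have e : (2 * n / (δ / k) : ℝ) = 2 * (n * k / δ) := by field_simp
  have hLM : L = Real.log 2 + Real.log (n * k / δ) := by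
    rw [hL, e, Real.log_mul two_ne_zero (by linarith)]
  have hM := Real.log_le_log two_pos hnk
  obtain ⟨v, r, l, hv, hl0, hlr, hr, hvL, hfail⟩ :=
    exists_varianceProxy hq hq2 (show 1 ≤ L by linarith)
  obtain ⟨l', hl0', hl1', htail⟩ := exists_state_tail_le (d := d) hn hk h0 h1
    (show v ≤ 94 * Real.log (n * k / δ) by linarith)
  refine (hv.run_not_signsGood_le hl0 hlr hl0' (hl1'.trans hr) hf x hx).trans ?_
  rw [ENNReal.ofReal_add (by positivity) (by positivity), Fintype.card_fin,
    ← ENNReal.ofReal_natCast n, ← ENNReal.ofReal_natCast d, ← ENNReal.ofReal_mul (by positivity),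
    ← ENNReal.ofReal_mul (by positivity)]
  refine add_le_add (ENNReal.ofReal_le_ofReal ?_) (ENNReal.ofReal_le_ofReal htail)
  have hexp : Real.exp (-L) = δ / k / (2 * n) := by
    rw [Real.exp_neg, hL, Real.exp_log (by positivity), inv_div]
  calc n * (2 * Real.exp (-(l * (min (1 / q) 9.3 * L)) + v * l ^ 2 / 2))
      ≤ n * (2 * Real.exp (-L)) := by gcongr
    _ = δ / k := by rw [hexp]; field_simp

/-! ### Treatment trees -/

namespace BinTree

variable {β : Type}

theorem leaves_prune (S : BinTree (Option β)) :
    (S.prune.map leaves).getD [] = S.leaves.filterMap id := by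
  induction S with
  | leaf b => cases b <;> simp [prune, leaves]
  | node l r hl hr =>
    simp only [prune, leaves, List.filterMap_append, ← hl, ← hr]
    rcases l.prune with _ | l' <;> rcases r.prune with _ | r' <;> simp [leaves]

theorem depth_prune_le {S : BinTree (Option β)} {h : ℕ} (hS : S.IsComplete h) {T : BinTree β}
    (hT : S.prune = some T) : T.depth ≤ h := by
  induction S generalizing h T with
  | leaf b =>
    rcases b with _ | b
    · simp [prune] at hT
    · simp only [prune, Option.some.injEq] at hT
      subst hT
      simp [depth]
  | node l r hl hr =>
    rcases h with _ | h
    · exact hS.elim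
    obtain ⟨hcl, hcr⟩ := hS
    simp only [prune] at hT
    rcases hpl : l.prune with _ | l' <;> rcases hpr : r.prune with _ | r' <;>
      simp only [hpl, hpr, Option.some.injEq, reduceCtorEq] at hT <;> subst hT
    · exact (hr hcr hpr).trans h.le_succ
    · exact (hl hcl hpl).trans h.le_succ
    · exact Nat.succ_le_succ (max_le (hl hcl hpl) (hr hcr hpr))

end BinTree

theorem count_filterMap_id {β : Type} [DecidableEq β] (L : List (Option β)) (m : β) :
    (L.filterMap id).count m = L.count (some m) := by
  induction L with
  | nil => rfl
  | cons o L ih => rcases o with _ | b <;> simpa [List.count_cons] using ih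

namespace IsTreatmentTree

variable {k : ℕ} {T : BinTree (Fin k)}

theorem count_leaves (h : IsTreatmentTree T) (m : Fin k) : T.leaves.count m = 1 := by
  obtain ⟨S, -, -, hc, hp⟩ := h
  have := S.leaves_prune
  rw [hp] at this
  simp only [Option.map_some, Option.getD_some] at this
  rw [this, count_filterMap_id, hc]

theorem nodup_leaves (h : IsTreatmentTree T) : T.leaves.Nodup :=
  List.nodup_iff_count_le_one.2 fun m => (h.count_leaves m).le

theorem mem_leaves (h : IsTreatmentTree T) (m : Fin k) : m ∈ T.leaves :=
  List.count_pos_iff.1 (by rw [h.count_leaves]; exact one_pos)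

theorem numNodes_lt (h : IsTreatmentTree T) : T.numNodes + 1 ≤ k := by
  rw [← T.length_leaves]
  simpa using h.nodup_leaves.length_le_card

theorem depth_le (h : IsTreatmentTree T) : T.depth ≤ Nat.clog 2 k := by
  obtain ⟨S, hc, -, -, hp⟩ := h
  exact BinTree.depth_prune_le hc hp

end IsTreatmentTree

theorem clog_two_le_three_mul_log {k : ℕ} (hk : 1 ≤ k) :
    (Nat.clog 2 k : ℝ) ≤ 3 * Real.log k := by
  rcases hk.eq_or_lt with rfl | hk
  · simp
  have h1 : 1 ≤ Nat.clog 2 k := Nat.clog_pos one_lt_two hk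
  have h2 : 2 ^ (Nat.clog 2 k - 1) < k := Nat.pow_pred_clog_lt_self one_lt_two hk
  have h3 : ((Nat.clog 2 k - 1 : ℕ) : ℝ) * Real.log 2 ≤ Real.log k := by
    rw [← Real.log_pow]
    exact Real.log_le_log (by positivity) (by exact_mod_cast h2.le)
  rw [Nat.cast_sub h1, Nat.cast_one] at h3
  have h4 : Real.log 2 ≤ Real.log k := Real.log_le_log two_pos (by exact_mod_cast hk)
  have := Real.log_two_gt_d9
  nlinarith

/-! ### From balanced leaves to the discrepancy -/

/-- The coordinate vectors of `ℝᵈ` in the space of augmented covariates. -/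
def covariateDir (n d : ℕ) (j : Fin d) : EuclideanSpace ℝ (Fin n ⊕ Fin d) :=
  EuclideanSpace.single (Sum.inr j) 1

theorem inner_augment_covariateDir {n d : ℕ} (φ : ℝ) (x : Fin n → EuclideanSpace ℝ (Fin d))
    (i : Fin n) (j : Fin d) :
    inner ℝ (augment φ x i) (covariateDir n d j) = Real.sqrt (1 - φ) * x i j := by
  simp [covariateDir, augment, EuclideanSpace.inner_single_right]

theorem norm_augment_le_one {n d : ℕ} {φ : ℝ} (h0 : 0 ≤ φ) (h1 : φ ≤ 1)
    {x : Fin n → EuclideanSpace ℝ (Fin d)} (hx : ∀ i, ‖x i‖ ≤ 1) (i : Fin n) :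
    ‖augment φ x i‖ ≤ 1 := by
  have h : ‖augment φ x i‖ ^ 2 = φ + (1 - φ) * ‖x i‖ ^ 2 := by
    rw [EuclideanSpace.norm_sq_eq, EuclideanSpace.norm_sq_eq, Fintype.sum_sum_type,
      Finset.mul_sum]
    simp [augment, mul_pow, Real.sq_sqrt h0, Real.sq_sqrt (sub_nonneg.2 h1)]
  have h2 : ‖x i‖ ^ 2 ≤ 1 := by nlinarith [norm_nonneg (x i), hx i]
  have h3 : ‖augment φ x i‖ ^ 2 ≤ 1 := by rw [h]; nlinarith
  exact (sq_le_one_iff₀ (norm_nonneg _)).1 h3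

/-- If each group sum is within `D` of its proportional share of the total `S`, then the
discrepancy is at most `2 D`. -/
theorem multiDiscrepancy_le {n d k : ℕ} {α : Fin k → ℝ} (hα : ∀ m, 0 < α m)
    (x : Fin n → EuclideanSpace ℝ (Fin d)) (a : Fin n → Option (Fin k)) {W D : ℝ} (hD : 0 ≤ D)
    (S : Fin d → ℝ) (h : ∀ m j, |groupSum x a m j - α m / W * S j| ≤ D) :
    multiDiscrepancy α x a ≤ 2 * D := by
  refine Real.iSup_le (fun ⟨m, m'⟩ => ?_) (by positivity)
  have hm := hα m
  have hm' := hα m'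
  refine mul_le_mul_of_nonneg_left ?_ two_pos.le
  rw [norm_smul, Real.norm_eq_abs, abs_of_pos (by positivity), inv_mul_le_iff₀ (by positivity)]
  refine (pi_norm_le_iff_of_nonneg (by positivity)).2 fun j => ?_
  simp only [Pi.sub_apply, Pi.smul_apply, smul_eq_mul, Real.norm_eq_abs]
  have e : (α m)⁻¹ * groupSum x a m j - (α m')⁻¹ * groupSum x a m' j =
      (α m)⁻¹ * (groupSum x a m j - α m / W * S j) -
        (α m')⁻¹ * (groupSum x a m' j - α m' / W * S j) := by
    field_simp; ring
  rw [e]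
  refine (abs_sub _ _).trans ?_
  rw [abs_mul, abs_mul, abs_of_pos (inv_pos.2 hm), abs_of_pos (inv_pos.2 hm'), one_div, one_div,
    add_mul]
  exact add_le_add (mul_le_mul_of_nonneg_left (h m j) (inv_pos.2 hm).le)
    (mul_le_mul_of_nonneg_left (h m' j) (inv_pos.2 hm').le)

theorem TreeGood.multiDiscrepancy_le {n d k : ℕ} {α : Fin k → ℝ} (hα : ∀ m, 0 < α m)
    {x : Fin n → EuclideanSpace ℝ (Fin d)} {φ t : ℝ} (h1 : φ < 1) (ht : 0 ≤ t)
    {T : BinTree (Fin k)} (hT : ∀ m, m ∈ T.leaves) {a : Fin n → Option (Fin k)}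
    (h : TreeGood α t (covariateDir n d) T (fun i => some (augment φ x i)) a) :
    multiDiscrepancy α x a ≤ T.depth * t / Real.sqrt (1 - φ) := by
  have hs : 0 < Real.sqrt (1 - φ) := Real.sqrt_pos.2 (by linarith)
  refine (KGroup.multiDiscrepancy_le hα x a (W := T.weight α)
    (D := T.depth * (t / 2) / Real.sqrt (1 - φ)) (by positivity) (fun j => ∑ i, x i j)
    fun m j => ?_).trans (le_of_eq (by ring))
  have key := h.2.2 m (hT m) j
  simp only [inputInner, inner_augment_covariateDir, ← Finset.mul_sum] at key
  have e : (∑ i, if a i = some m then Real.sqrt (1 - φ) * x i j else 0) =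
      Real.sqrt (1 - φ) * groupSum x a m j := by
    rw [groupSum, Finset.mul_sum]
    exact Finset.sum_congr rfl fun i _ => by split_ifs <;> simp
  rw [e, mul_left_comm, ← mul_sub, abs_mul, abs_of_pos hs] at key
  rw [le_div_iff₀ hs, mul_comm]
  exact key

theorem log_div_nonneg {m k : ℕ} {δ : ℝ} (h0 : 0 < δ) (h1 : δ ≤ 1) :
    0 ≤ Real.log (m * k / δ) := by
  rcases Nat.eq_zero_or_pos (m * k) with h | h
  · rw [← Nat.cast_mul, h]; simp
  · have : (1 : ℝ) ≤ m * k := by exact_mod_cast h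
    exact Real.log_nonneg ((one_le_div h0).2 (h1.trans this))

end

end KGroup

end

open KGroup in
theorem theorem2 :
    ∃ C : ℝ, 0 < C ∧
      ∀ (n d k : ℕ) (x : Fin n → EuclideanSpace ℝ (Fin d)) (α : Fin k → ℝ)
        (T : KGroup.BinTree (Fin k)) (φ δ : ℝ),
        (∀ i, ‖x i‖ ≤ 1) → (∀ m, 0 < α m) →
        KGroup.IsTreatmentTree T → T.LighterLeft α →
        0 < φ → φ < 1 → 0 < δ → δ < 1 →
        ENNReal.ofReal (1 - δ) ≤
          (KGroup.kGroupBalance T α φ δ x).toOuterMeasure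
            {a | (∀ i, ∃ m, a i = some m) ∧
              KGroup.multiDiscrepancy α x a ≤
                C * Real.log k *
                  Real.sqrt (d * Real.log (d * k / δ) * Real.log (n * k / δ) /
                    (φ * (1 - φ)))} := by
  refine ⟨108, by norm_num, fun n d k x α T φ δ hx hα hT hTα hφ0 hφ1 hδ0 hδ1 => ?_⟩
  have hk : 1 ≤ k := le_trans (by omega) hT.numNodes_lt
  set t := stateBound n d k δ with ht
  have ht0 : 0 ≤ t := by rw [ht, stateBound]; positivity
  set y : Fin n → Option (EuclideanSpace ℝ (Fin n ⊕ Fin d)) := fun i => some (augment φ x i)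
  have hy : ∀ i z, y i = some z → ‖z‖ ≤ 1 := fun i z hz => by
    rw [← Option.some.inj hz]; exact norm_augment_le_one hφ0.le hφ1.le hx i
  set f := covariateDir n d
  have hf : ∀ j, ‖f j‖ ≤ 1 := fun j => by simp [f, covariateDir]
  set G : Set (Fin n → Option (Fin k)) := {a | TreeGood α t f T y a}
  have hε : ∃ ε : ℝ≥0∞, (∀ q, 0 < q → q ≤ 1 / 2 →
      ∀ x : Fin n → Option (EuclideanSpace ℝ (Fin n ⊕ Fin d)),
      (∀ i y, x i = some y → ‖y‖ ≤ 1) →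
      (run (nodeStep q (threshold n (δ / k) q)) n x 0).toOuterMeasure
        {s | ¬ SignsGood q t f x s} ≤ ε) ∧ T.numNodes * ε ≤ ENNReal.ofReal δ := by
    rcases Nat.eq_zero_or_pos n with rfl | hn
    · refine ⟨0, fun q _ _ x _ => ?_, by simp⟩
      simp [SignsGood, ht0]
    rcases hk.eq_or_lt with hk1 | hk2
    · have : T.numNodes = 0 := by have := hT.numNodes_lt; omega
      exact ⟨1, fun q _ _ x _ => toOuterMeasure_le_one _ _, by simp [this]⟩
    refine ⟨_, fun q hq hq2 x hx => run_not_signsGood_threshold_le hn hk2 hδ0 hδ1 hq hq2 hf x hx,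
      ?_⟩
    rw [← ENNReal.ofReal_natCast, ← ENNReal.ofReal_mul (by positivity)]
    apply ENNReal.ofReal_le_ofReal
    have hN : (T.numNodes : ℝ) ≤ k - 1 := by
      have : ((T.numNodes + 1 : ℕ) : ℝ) ≤ k := by exact_mod_cast hT.numNodes_lt
      push_cast at this; linarith
    have hk0 : (0 : ℝ) < k := by exact_mod_cast hk
    calc T.numNodes * (δ / k + δ / k ^ 2) ≤ (k - 1) * (δ / k + δ / k ^ 2) := by gcongr
      _ = δ - δ / k ^ 2 := by field_simp; ring
      _ ≤ δ := by have : 0 ≤ δ / (k : ℝ) ^ 2 := by positivity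
                  linarith
  obtain ⟨ε, hnode, hεδ⟩ := hε
  set P := kGroupBalance T α φ δ x with hP
  have hbad : P.toOuterMeasure Gᶜ ≤ ENNReal.ofReal δ := by
    rw [hP, kGroupBalance, assignAll_eq_run]
    exact (run_not_treeGood_le hα hnode T hTα hT.nodup_leaves y hy).trans hεδ
  have hgood : ENNReal.ofReal (1 - δ) ≤ P.toOuterMeasure G := by
    rw [ENNReal.ofReal_sub _ hδ0.le, ENNReal.ofReal_one]
    refine tsub_le_iff_right.2 (le_trans ?_ (add_le_add_right hbad _))
    have h1 : P.toOuterMeasure Set.univ = 1 :=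
      (PMF.toOuterMeasure_apply_eq_one_iff _ _).2 (Set.subset_univ _)
    rw [← h1, ← Set.union_compl_self G]
    exact MeasureTheory.measure_union_le _ _
  refine hgood.trans (MeasureTheory.measure_mono fun a ha => ⟨fun i => ?_, ?_⟩)
  · obtain ⟨m, -, hm⟩ := ha.2.1 i (by simp [y])
    exact ⟨m, hm⟩
  · refine (TreeGood.multiDiscrepancy_le hα hφ1 ht0 hT.mem_leaves ha).trans ?_
    have hdepth : (T.depth : ℝ) ≤ 3 * Real.log k :=
      le_trans (by exact_mod_cast hT.depth_le) (clog_two_le_three_mul_log hk)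
    set X := d * Real.log (d * k / δ) * Real.log (n * k / δ)
    have hX : 0 ≤ X :=
      mul_nonneg (mul_nonneg d.cast_nonneg (log_div_nonneg hδ0 hδ1.le)) (log_div_nonneg hδ0 hδ1.le)
    have hφ : 0 < 1 - φ := by linarith
    have hlogk : 0 ≤ Real.log k := Real.log_natCast_nonneg k
    calc T.depth * t / Real.sqrt (1 - φ)
        ≤ 3 * Real.log k * t / Real.sqrt (1 - φ) := by gcongr
      _ = 108 * Real.log k * Real.sqrt (X / (1 - φ)) := by
        rw [Real.sqrt_div hX, ht, stateBound]; ring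
      _ ≤ 108 * Real.log k * Real.sqrt (X / (φ * (1 - φ))) := by
        have : φ * (1 - φ) ≤ 1 - φ := by nlinarith
        gcongr
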